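/- Let $2\le n\le m$, let $A\in\mathbb{C}^{m\times n}$ be a tall matrix with singular values $\sigma_1\ge\cdots\ge\sigma_n>0$, and let $S\in\mathbb{C}^{d\times m}$ be a subspace embedding for $A$ with distortion $\eta\in[0,1)$, that is, $(1-\eta)\|Ay\|^2\le\|SAy\|^2\le(1+\eta)\|Ay\|^2$ for all $y\in\mathbb{C}^n$ (Euclidean norms). Put $\mathrm{gap}=(\sigma_{n-1}^2-\sigma_n^2)/\sigma_n^2$ and suppose that $\eta<\mathrm{gap}/(2+\mathrm{gap})$. Let $SA=U\Sigma V^*$ be any economy-size singular value decomposition (singular values in decreasing order), let $P=V\Sigma^{-1}$, and let $v_0,v_1,v_2,\dots$ be any sequence of RLOBPCG iterates: $v_{-1}=v_0=Pe_n/\|Pe_n\|$, where $e_n$ is the last standard basis vector, and for $i=0,1,2,\dots$ $$w_i=P\big(P^*\big(A^*(Av_i)-\|Av_i\|^2v_i\big)\big),\qquad v_{i+1}\in\operatorname{argmin}\{\|Az\| : z\in\operatorname{span}\{v_{i-1},v_i,w_i\},\ \|z\|=1\}.$$ Let $v_{\min}$ be a unit right singular vector of $A$ for $\sigma_n$, and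 let $\measuredangle(x,y)=\arccos\big(|\langle x,y\rangle|/(\|x\|\|y\|)\big)$ denote the angle between (the complex lines spanned by) two nonzero vectors. Then, for every $k\ge0$, $$\frac{\|Av_k\|^2-\sigma_n^2}{\sigma_n^2}\le C\cdot\mathrm{gap}\cdot q^{2k},\qquad |\sin\measuredangle(v_k,v_{\min})|\le|\tan\measuredangle(v_k,v_{\min})|\le C^{1/2}q^k,$$ where $C=\dfrac{2\eta}{(1-\eta)\,\mathrm{gap}-2\eta}$ and $q=\eta+\dfrac{1-\eta}{1+\mathrm{gap}}$. -/

import Mathlib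

open scoped Matrix

noncomputable section

namespace RLOBPCG

/-- Column vectors in `ℂⁿ`, with the Euclidean norm. -/
abbrev Vec (n : ℕ) : Type := EuclideanSpace ℂ (Fin n)

/-- The action of a complex matrix on column vectors. -/
abbrev act {m n : ℕ} (A : Matrix (Fin m) (Fin n) ℂ) (x : Vec n) : Vec m :=
  Matrix.toEuclideanLin A x

/-- The `j`-th largest singular value `σ_j(A)`, for `1 ≤ j`, counted with multiplicity
(Mathlib numbers the singular values from `0`). -/
def sigma {m n : ℕ} (A : Matrix (Fin m) (Fin n) ℂ) (j : ℕ) : ℝ :=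
  (Matrix.toEuclideanLin A).singularValues (j - 1)

/-- The relative gap `(σ_{n-1}² - σ_n²) / σ_n²` of a matrix with `n` columns. -/
def relGap {m n : ℕ} (A : Matrix (Fin m) (Fin n) ℂ) : ℝ :=
  (sigma A (n - 1) ^ 2 - sigma A n ^ 2) / sigma A n ^ 2

/-- The two-sided inequality saying that `S` is a subspace embedding for `A` with distortion `η`. -/
def IsSubspaceEmbedding {d m n : ℕ} (S : Matrix (Fin d) (Fin m) ℂ) (A : Matrix (Fin m) (Fin n) ℂ)
    (η : ℝ) : Prop :=
  ∀ y : Vec n,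
    (1 - η) * ‖act A y‖ ^ 2 ≤ ‖act S (act A y)‖ ^ 2 ∧
      ‖act S (act A y)‖ ^ 2 ≤ (1 + η) * ‖act A y‖ ^ 2

/-- `v` is a unit right singular vector of `A` for the smallest singular value `σ_n`. -/
structure IsMinRightSingularVector {m n : ℕ} (A : Matrix (Fin m) (Fin n) ℂ) (v : Vec n) :
    Prop where
  unit : ‖v‖ = 1
  gram : act Aᴴ (act A v) = (((sigma A n) ^ 2 : ℝ) : ℂ) • v

/-- `M = U Σ V*` is an economy-size singular value decomposition of the `d × n` matrix `M`:
`U` is `d × n` with orthonormal columns, `Σ = diag(s)` with `s₁ ≥ s₂ ≥ ⋯ ≥ 0`, and `V` is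
unitary. -/
structure IsEconomySVD {d n : ℕ} (M : Matrix (Fin d) (Fin n) ℂ) (U : Matrix (Fin d) (Fin n) ℂ)
    (s : Fin n → ℝ) (V : Matrix (Fin n) (Fin n) ℂ) : Prop where
  left_orthonormal : Uᴴ * U = 1
  right_unitary : V ∈ Matrix.unitaryGroup (Fin n) ℂ
  nonneg : ∀ i, 0 ≤ s i
  antitone : Antitone s
  factorization : M = U * Matrix.diagonal (fun i => (s i : ℂ)) * Vᴴ

/-- The preconditioner `P = V Σ⁻¹`. -/
def preconditioner {n : ℕ} (s : Fin n → ℝ) (V : Matrix (Fin n) (Fin n) ℂ) :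
    Matrix (Fin n) (Fin n) ℂ :=
  V * Matrix.diagonal (fun i => ((s i)⁻¹ : ℂ))

/-- The last standard basis vector `e_n` of `ℂⁿ`. -/
def lastBasisVec (n : ℕ) : Vec n :=
  WithLp.toLp 2 (fun i : Fin n => if (i : ℕ) + 1 = n then 1 else 0)

/-- The sketch-and-solve starting vector `P e_n / ‖P e_n‖`. -/
def startVec {n : ℕ} (P : Matrix (Fin n) (Fin n) ℂ) : Vec n :=
  ((‖act P (lastBasisVec n)‖⁻¹ : ℝ) : ℂ) • act P (lastBasisVec n)

/-- The preconditioned search direction `w = P (P* (A* (A v) - ‖A v‖² v))`. -/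
def searchDir {m n : ℕ} (A : Matrix (Fin m) (Fin n) ℂ) (P : Matrix (Fin n) (Fin n) ℂ)
    (v : Vec n) : Vec n :=
  act P (act Pᴴ (act Aᴴ (act A v) - ((‖act A v‖ ^ 2 : ℝ) : ℂ) • v))

/-- The unit vectors of the trial space `span {v_old, v, w}`. -/
def trialSphere {m n : ℕ} (A : Matrix (Fin m) (Fin n) ℂ) (P : Matrix (Fin n) (Fin n) ℂ)
    (vOld v : Vec n) : Set (Vec n) :=
  {z | z ∈ Submodule.span ℂ {vOld, v, searchDir A P v} ∧ ‖z‖ = 1}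

/-- One LOBPCG step for `A* A` with preconditioner `P P*`: `vNew` is a minimizer of `‖A z‖` over
the unit vectors `z` of the trial space. Minimizers are never unique (a phase is free); any one of
them is allowed. -/
structure IsLOBPCGStep {m n : ℕ} (A : Matrix (Fin m) (Fin n) ℂ) (P : Matrix (Fin n) (Fin n) ℂ)
    (vOld v vNew : Vec n) : Prop where
  mem : vNew ∈ trialSphere A P vOld v
  isMin : IsMinOn (fun z => ‖act A z‖) (trialSphere A P vOld v) vNew

/-- `v 0, v 1, v 2, …` are the iterates of LOBPCG for `A* A` with preconditioner `P P*`, started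
from `v₋₁ = v₀ = P e_n / ‖P e_n‖`. -/
structure IsIteration {m n : ℕ} (A : Matrix (Fin m) (Fin n) ℂ) (P : Matrix (Fin n) (Fin n) ℂ)
    (v : ℕ → Vec n) : Prop where
  start : v 0 = startVec P
  first : IsLOBPCGStep A P (v 0) (v 0) (v 1)
  next : ∀ i, IsLOBPCGStep A P (v i) (v (i + 1)) (v (i + 2))

/-- The angle in `[0, π/2]` between the complex lines spanned by two nonzero vectors,
`arccos (|⟨x, y⟩| / (‖x‖ ‖y‖))`. -/
def lineAngle {n : ℕ} (x y : Vec n) : ℝ :=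
  Real.arccos (‖inner ℂ x y‖ / (‖x‖ * ‖y‖))

/-- The prefactor `C = 2 η / ((1 - η) gap - 2 η)`. -/
def prefactor (η gap : ℝ) : ℝ := 2 * η / ((1 - η) * gap - 2 * η)

/-- The convergence rate `q = η + (1 - η) / (1 + gap)`. -/
def rate (η gap : ℝ) : ℝ := η + (1 - η) / (1 + gap)

end RLOBPCG

end

/-!
Write `H = A* A`, with smallest eigenvalues `λ₁ = σ_n²` and `λ₂ = σ_{n-1}²`, and `ρ(v) = ‖A v‖²` for
the Rayleigh quotient at a unit vector. The proof follows the ratio `(ρ - λ₁) / (λ₂ - ρ)`: it starts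
at most at `C`, because the starting vector minimizes the sketched objective and is therefore optimal
up to the factor `(1 + η) / (1 - η)`, and every LOBPCG step multiplies it by at most `q²`
(`IsLOBPCGStep.ratio_le`). It dominates the squared tangent of the angle to the minimal right singular
vector (`sin_le_tan_and_tan_le`).

For the contraction, the LOBPCG minimizer is compared with one vector of the trial space, the
preconditioned gradient iterate `z = v - (1 - η²) w`. The preconditioner inverts the sketched Gram
matrix, so the embedding property puts `z` within `H`-distance `η ‖g‖_H` of `ρ H⁻¹ v`, where
`g = v - ρ H⁻¹ v` (`norm_map_sub_smul_le`).

It remains to see that such an inexact inverse iteration has rate `q = η + (1 - η) λ₁ / λ₂`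
(`sum_erase_le_of_mem_ball`). Put `y = H^(1/2) v`, `K = H⁻¹` and let `μ = 1 / ρ` be the Rayleigh
quotient of `K` at `y`. The step is a point of the ball around `K y` of radius `η ‖μ y - K y‖`, hence
a convex combination, with weights `1 - η` and `η`, of `K y` and of a point in the ball of the full
radius `‖μ y - K y‖`. The cone `{ρ_K ≥ μ}` around the dominant eigenvector of `K` is described by a
seminorm `N` of the transversal part. Exact iteration shrinks `N` relative to the dominant component
by `λ₁ / λ₂`, and the full ball stays in the cone (`sum_rayleigh_nonneg_of_mem_ball`, a completion of
squares), so the rate is the convex combination of `λ₁ / λ₂` and `1`.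
-/

namespace RLOBPCG

/-! ### Weighted sums of squares in spectral coordinates -/

/-- Minkowski's inequality for a weighted `ℓ²` seminorm. -/
theorem sqrt_sum_mul_sq_norm_add_le {ι : Type*} (t : Finset ι) {w : ι → ℝ}
    (hw : ∀ j ∈ t, 0 ≤ w j) (a b : ι → ℂ) :
    √(∑ j ∈ t, w j * ‖a j + b j‖ ^ 2) ≤
      √(∑ j ∈ t, w j * ‖a j‖ ^ 2) + √(∑ j ∈ t, w j * ‖b j‖ ^ 2) := by
  have key (c : ι → ℂ) : √(∑ j ∈ t, w j * ‖c j‖ ^ 2) =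
      ‖WithLp.toLp 2 (fun j : t => ((√(w j) : ℝ) : ℂ) * c j)‖ := by
    rw [EuclideanSpace.norm_eq, ← Finset.sum_coe_sort t]
    congr 1
    refine Finset.sum_congr rfl fun j _ => ?_
    simp only [norm_mul, mul_pow, Complex.norm_real, Real.norm_eq_abs, sq_abs,
      Real.sq_sqrt (hw j j.2)]
  rw [key, key, key]
  refine le_trans (le_of_eq ?_) (norm_add_le _ _)
  congr 1
  ext j
  simp [mul_add]

/-- The closed ball around `K y` of radius `‖μ y - K y‖`, where `μ` is the Rayleigh quotient of the
positive semidefinite operator `K = diag κ` at `y`, lies in the cone where the Rayleigh quotient of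
`K` is at least `μ`. -/
theorem sum_rayleigh_nonneg_of_mem_ball {ι : Type*} [Fintype ι] {κ : ι → ℝ} {μ : ℝ}
    (hκ : ∀ j, 0 ≤ κ j) (hμ : 0 ≤ μ) {y b : ι → ℂ}
    (hy : ∑ j, (μ - κ j) * ‖y j‖ ^ 2 = 0)
    (hb : ∑ j, ‖b j - κ j * y j‖ ^ 2 ≤ ∑ j, (μ - κ j) ^ 2 * ‖y j‖ ^ 2) :
    0 ≤ ∑ j, (κ j - μ) * ‖b j‖ ^ 2 := by
  have pointwise (j : ι) : (κ j - μ) * ‖b j‖ ^ 2 = κ j * ‖b j - μ * y j‖ ^ 2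
      - μ * (‖b j - κ j * y j‖ ^ 2 - (μ - κ j) ^ 2 * ‖y j‖ ^ 2)
      - μ ^ 2 * ((μ - κ j) * ‖y j‖ ^ 2) := by
    simp only [← Complex.normSq_eq_norm_sq, Complex.normSq_apply, Complex.sub_re, Complex.sub_im,
      Complex.mul_re, Complex.mul_im, Complex.ofReal_re, Complex.ofReal_im]
    ring
  have hsq : 0 ≤ ∑ j, κ j * ‖b j - μ * y j‖ ^ 2 :=
    Finset.sum_nonneg fun j _ => mul_nonneg (hκ j) (sq_nonneg _)
  simp_rw [pointwise, Finset.sum_sub_distrib, ← Finset.mul_sum, Finset.sum_sub_distrib]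
  rw [hy]
  nlinarith

theorem sum_eq_add_sum_erase {ι : Type*} [Fintype ι] [DecidableEq ι] (i₀ : ι) (f : ι → ℝ) :
    ∑ j, f j = f i₀ + ∑ j ∈ Finset.univ.erase i₀, f j :=
  (Finset.add_sum_erase _ _ (Finset.mem_univ i₀)).symm

/-! ### The preconditioned power step -/

section Cone

variable {ι : Type*} [Fintype ι] [DecidableEq ι] {κ : ι → ℝ} {i₀ : ι} {m₂ μ : ℝ} {y : ι → ℂ}

/-- A perturbation `d` of `K y` by at most the residual `‖μ y - K y‖` keeps the vector in the cone,
even after its component along the dominant eigenvector has been shortened by `‖d i₀‖`. -/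
theorem sqrt_sum_erase_add_le (hκ : ∀ j, 0 ≤ κ j) (hm : ∀ j, j ≠ i₀ → κ j ≤ m₂)
    (hm₂ : m₂ < μ) (hμ : μ ≤ κ i₀) (hμ0 : 0 < μ) (hy0 : y i₀ ≠ 0)
    (hy : ∑ j, (μ - κ j) * ‖y j‖ ^ 2 = 0) {d : ι → ℂ}
    (hd : ∑ j, ‖d j‖ ^ 2 ≤ ∑ j, (μ - κ j) ^ 2 * ‖y j‖ ^ 2) :
    ‖d i₀‖ ≤ κ i₀ * ‖y i₀‖ ∧
      √(∑ j ∈ Finset.univ.erase i₀, (μ - κ j) * ‖κ j * y j + d j‖ ^ 2) ≤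
        √(κ i₀ - μ) * (κ i₀ * ‖y i₀‖ - ‖d i₀‖) := by
  have hY : 0 < ‖y i₀‖ := norm_pos_iff.mpr hy0
  have hd0 : ‖d i₀‖ ≤ κ i₀ * ‖y i₀‖ := by
    have h1 : ‖d i₀‖ ^ 2 ≤ ∑ j, ‖d j‖ ^ 2 :=
      Finset.single_le_sum (f := fun j => ‖d j‖ ^ 2) (fun j _ => sq_nonneg _) (Finset.mem_univ i₀)
    have h2 : ∑ j ∈ Finset.univ.erase i₀, (μ - κ j) ^ 2 * ‖y j‖ ^ 2 ≤
        μ * ∑ j ∈ Finset.univ.erase i₀, (μ - κ j) * ‖y j‖ ^ 2 := by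
      rw [Finset.mul_sum]
      refine Finset.sum_le_sum fun j hj => ?_
      have := hm j (Finset.ne_of_mem_erase hj)
      have h3 : 0 ≤ (μ - κ j) * ‖y j‖ ^ 2 := mul_nonneg (by linarith) (sq_nonneg _)
      nlinarith [mul_nonneg (hκ j) h3]
    rw [sum_eq_add_sum_erase i₀] at hy hd
    rw [sum_eq_add_sum_erase i₀ (fun j => ‖d j‖ ^ 2)] at h1
    rw [sum_eq_add_sum_erase i₀ (fun j => (μ - κ j) ^ 2 * ‖y j‖ ^ 2)] at hd
    have h4 : ‖d i₀‖ ^ 2 ≤ (κ i₀ * ‖y i₀‖) ^ 2 := by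
      have h5 : 0 ≤ κ i₀ * μ * ‖y i₀‖ ^ 2 := by positivity [hκ i₀]
      nlinarith
    exact le_of_sq_le_sq h4 (by positivity [hκ i₀])
  refine ⟨hd0, ?_⟩
  -- The component along `i₀` is replaced by the real multiple of `y i₀` of the smallest modulus
  -- that keeps the distance `‖d i₀‖` to `κ i₀ * y i₀`.
  set b : ι → ℂ := Function.update (fun j => κ j * y j + d j) i₀
    (((κ i₀ - ‖d i₀‖ / ‖y i₀‖ : ℝ) : ℂ) * y i₀) with hb
  have hbne (j : ι) (hj : j ≠ i₀) : b j = κ j * y j + d j := by simp [hb, hj]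
  have hb0 : b i₀ = ((κ i₀ - ‖d i₀‖ / ‖y i₀‖ : ℝ) : ℂ) * y i₀ := by simp [hb]
  have hbnorm : ‖b i₀‖ = κ i₀ * ‖y i₀‖ - ‖d i₀‖ := by
    have : 0 ≤ κ i₀ - ‖d i₀‖ / ‖y i₀‖ := by rw [sub_nonneg, div_le_iff₀ hY]; exact hd0
    rw [hb0, norm_mul, Complex.norm_real, Real.norm_eq_abs, abs_of_nonneg this]
    field_simp
  have hbd (j : ι) : ‖b j - κ j * y j‖ = ‖d j‖ := by
    by_cases hj : j = i₀
    · subst hj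
      have : b j - κ j * y j = ((-(‖d j‖ / ‖y j‖) : ℝ) : ℂ) * y j := by
        rw [hb0]; push_cast; ring
      rw [this, norm_mul, Complex.norm_real, Real.norm_eq_abs, abs_neg, abs_of_nonneg (by positivity)]
      field_simp
    · rw [hbne j hj, add_sub_cancel_left]
  have hcone := sum_rayleigh_nonneg_of_mem_ball hκ hμ0.le hy (b := b) (by simpa [hbd] using hd)
  rw [sum_eq_add_sum_erase i₀, hbnorm] at hcone
  have hsum : ∑ j ∈ Finset.univ.erase i₀, (κ j - μ) * ‖b j‖ ^ 2 =
      -∑ j ∈ Finset.univ.erase i₀, (μ - κ j) * ‖κ j * y j + d j‖ ^ 2 := by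
    rw [← Finset.sum_neg_distrib]
    refine Finset.sum_congr rfl fun j hj => ?_
    rw [hbne j (Finset.ne_of_mem_erase hj)]
    ring
  rw [← Real.sqrt_sq (sub_nonneg.mpr hd0), ← Real.sqrt_mul (by linarith)]
  exact Real.sqrt_le_sqrt (by linarith)

/-- The preconditioned power step with error `γ` contracts, up to the factor
`γ + (1 - γ) m₂ / κ i₀`, the opening of the cone around the dominant eigenvector: `z` is the convex
combination, with weights `1 - γ` and `γ`, of `K y` and of a point in the ball of the full residual
radius. -/
theorem sum_erase_le_of_mem_ball (hκ : ∀ j, 0 ≤ κ j) (hm : ∀ j, j ≠ i₀ → κ j ≤ m₂)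
    (hm0 : 0 ≤ m₂) (hm₂ : m₂ < μ) (hμ : μ ≤ κ i₀) (hμ0 : 0 < μ) (hy0 : y i₀ ≠ 0)
    (hy : ∑ j, (μ - κ j) * ‖y j‖ ^ 2 = 0) {γ : ℝ} (hγ0 : 0 ≤ γ) (hγ1 : γ < 1) {z : ι → ℂ}
    (hz : ∑ j, ‖z j - κ j * y j‖ ^ 2 ≤ γ ^ 2 * ∑ j, (μ - κ j) ^ 2 * ‖y j‖ ^ 2) :
    z i₀ ≠ 0 ∧ ∑ j ∈ Finset.univ.erase i₀, (μ - κ j) * ‖z j‖ ^ 2 ≤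
      (γ + (1 - γ) * (m₂ / κ i₀)) ^ 2 * ((κ i₀ - μ) * ‖z i₀‖ ^ 2) := by
  have hY : 0 < ‖y i₀‖ := norm_pos_iff.mpr hy0
  have hk0 : 0 < κ i₀ := hμ0.trans_le hμ
  obtain ⟨d, hzd, hd⟩ : ∃ d : ι → ℂ, (∀ j, z j = κ j * y j + γ * d j) ∧
      ∑ j, ‖d j‖ ^ 2 ≤ ∑ j, (μ - κ j) ^ 2 * ‖y j‖ ^ 2 := by
    rcases hγ0.eq_or_lt with rfl | hγ
    · refine ⟨0, fun j => ?_, ?_⟩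
      · have h0 : ∑ j, ‖z j - κ j * y j‖ ^ 2 = 0 :=
          le_antisymm (by simpa using hz) (Finset.sum_nonneg fun _ _ => sq_nonneg _)
        have := (Finset.sum_eq_zero_iff_of_nonneg fun _ _ => sq_nonneg _).mp h0 j
          (Finset.mem_univ j)
        simpa [sub_eq_zero] using this
      · simpa using Finset.sum_nonneg fun j _ => by positivity
    · have hγC : (γ : ℂ) ≠ 0 := by exact_mod_cast hγ.ne'
      refine ⟨fun j => (γ : ℂ)⁻¹ * (z j - κ j * y j), fun j => by field_simp; ring, ?_⟩
      simp only [norm_mul, norm_inv, Complex.norm_real, Real.norm_eq_abs, abs_of_pos hγ, mul_pow,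
        ← Finset.mul_sum]
      rw [inv_pow, inv_mul_le_iff₀ (by positivity)]
      exact hz
  obtain ⟨hd0, hball⟩ := sqrt_sum_erase_add_le hκ hm hm₂ hμ hμ0 hy0 hy hd
  have hw : ∀ j ∈ Finset.univ.erase i₀, 0 ≤ μ - κ j := fun j hj => by
    linarith [hm j (Finset.ne_of_mem_erase hj)]
  have hcenter : √(∑ j ∈ Finset.univ.erase i₀, (μ - κ j) * ‖κ j * y j‖ ^ 2) ≤
      √(κ i₀ - μ) * (m₂ * ‖y i₀‖) := by
    rw [← Real.sqrt_sq (mul_nonneg hm0 hY.le), ← Real.sqrt_mul (by linarith)]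
    refine Real.sqrt_le_sqrt ?_
    have h1 : ∑ j ∈ Finset.univ.erase i₀, (μ - κ j) * ‖κ j * y j‖ ^ 2 ≤
        m₂ ^ 2 * ∑ j ∈ Finset.univ.erase i₀, (μ - κ j) * ‖y j‖ ^ 2 := by
      rw [Finset.mul_sum]
      refine Finset.sum_le_sum fun j hj => ?_
      have h2 : κ j ^ 2 ≤ m₂ ^ 2 := pow_le_pow_left₀ (hκ j) (hm j (Finset.ne_of_mem_erase hj)) 2
      rw [norm_mul, Complex.norm_real, Real.norm_eq_abs, mul_pow, sq_abs]
      calc (μ - κ j) * (κ j ^ 2 * ‖y j‖ ^ 2) = κ j ^ 2 * ((μ - κ j) * ‖y j‖ ^ 2) := by ring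
        _ ≤ _ := mul_le_mul_of_nonneg_right h2 (mul_nonneg (hw j hj) (sq_nonneg _))
    rw [sum_eq_add_sum_erase i₀] at hy
    calc _ ≤ _ := h1
      _ = _ := by
        rw [show ∑ j ∈ Finset.univ.erase i₀, (μ - κ j) * ‖y j‖ ^ 2 = (κ i₀ - μ) * ‖y i₀‖ ^ 2 by
          linarith]
        ring
  have hscale (c : ℝ) (hc : 0 ≤ c) (a : ι → ℂ) :
      √(∑ j ∈ Finset.univ.erase i₀, (μ - κ j) * ‖c * a j‖ ^ 2) =
        c * √(∑ j ∈ Finset.univ.erase i₀, (μ - κ j) * ‖a j‖ ^ 2) := by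
    rw [← Real.sqrt_sq hc, ← Real.sqrt_mul (sq_nonneg _), Real.sqrt_sq hc, Finset.mul_sum]
    congr 1
    refine Finset.sum_congr rfl fun j _ => ?_
    rw [norm_mul, Complex.norm_real, Real.norm_eq_abs, mul_pow, sq_abs]
    ring
  have htri := sqrt_sum_mul_sq_norm_add_le (Finset.univ.erase i₀) hw
    (fun j => ((1 - γ : ℝ) : ℂ) * (κ j * y j)) (fun j => (γ : ℂ) * (κ j * y j + d j))
  rw [hscale _ (by linarith), hscale _ hγ0] at htri
  have hsplit (j : ι) : ((1 - γ : ℝ) : ℂ) * (κ j * y j) + γ * (κ j * y j + d j) = z j := by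
    rw [hzd]; push_cast; ring
  simp only [hsplit] at htri
  have hz0 : κ i₀ * ‖y i₀‖ - γ * ‖d i₀‖ ≤ ‖z i₀‖ := by
    rw [hzd]
    have h := norm_sub_le_norm_add (κ i₀ * y i₀) (γ * d i₀)
    simpa [abs_of_nonneg, hγ0, hk0.le] using h
  have hz0pos : 0 < κ i₀ * ‖y i₀‖ - γ * ‖d i₀‖ := by
    have h1 : γ * ‖d i₀‖ ≤ γ * (κ i₀ * ‖y i₀‖) := mul_le_mul_of_nonneg_left hd0 hγ0
    have h2 : 0 < (1 - γ) * (κ i₀ * ‖y i₀‖) := mul_pos (by linarith) (by positivity)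
    linarith
  refine ⟨norm_pos_iff.mp (hz0pos.trans_le hz0), ?_⟩
  set q := γ + (1 - γ) * (m₂ / κ i₀) with hq
  have hqk : q * κ i₀ = γ * κ i₀ + (1 - γ) * m₂ := by rw [hq]; field_simp
  have hq0 : 0 ≤ q := add_nonneg hγ0 (mul_nonneg (by linarith) (div_nonneg hm0 hk0.le))
  have hq1 : q ≤ 1 := by
    have : m₂ / κ i₀ ≤ 1 := (div_le_one hk0).mpr (by linarith)
    nlinarith
  have hτ : 0 ≤ √(κ i₀ - μ) := Real.sqrt_nonneg _
  have hmain : √(∑ j ∈ Finset.univ.erase i₀, (μ - κ j) * ‖z j‖ ^ 2) ≤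
      q * (√(κ i₀ - μ) * ‖z i₀‖) := by
    calc _ ≤ _ := htri
      _ ≤ (1 - γ) * (√(κ i₀ - μ) * (m₂ * ‖y i₀‖)) +
          γ * (√(κ i₀ - μ) * (κ i₀ * ‖y i₀‖ - ‖d i₀‖)) :=
        add_le_add (mul_le_mul_of_nonneg_left hcenter (by linarith))
          (mul_le_mul_of_nonneg_left hball hγ0)
      _ = √(κ i₀ - μ) * (q * κ i₀ * ‖y i₀‖ - γ * ‖d i₀‖) := by rw [hqk]; ring
      _ ≤ √(κ i₀ - μ) * (q * κ i₀ * ‖y i₀‖ - q * (γ * ‖d i₀‖)) := by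
        refine mul_le_mul_of_nonneg_left (sub_le_sub_left ?_ _) hτ
        exact mul_le_of_le_one_left (by positivity) hq1
      _ = q * (√(κ i₀ - μ) * (κ i₀ * ‖y i₀‖ - γ * ‖d i₀‖)) := by ring
      _ ≤ _ := mul_le_mul_of_nonneg_left (mul_le_mul_of_nonneg_left hz0 hτ) hq0
  have hfin := pow_le_pow_left₀ (Real.sqrt_nonneg _) hmain 2
  rwa [Real.sq_sqrt (Finset.sum_nonneg fun j hj => mul_nonneg (hw j hj) (sq_nonneg _)), mul_pow,
    mul_pow, Real.sq_sqrt (by linarith)] at hfin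

end Cone


section Step

variable {ι : Type*} [Fintype ι] [DecidableEq ι] {lam : ι → ℝ} {i₀ : ι} {l₂ ρ : ℝ} {ξ ζ g : ι → ℂ}

/-- The cone contraction in terms of a positive operator `H = diag lam`: here `g = ξ - ρ H⁻¹ ξ`, and
`ζ` is within relative error `γ` of `ρ H⁻¹ ξ` in the `H`-norm. It is the contraction for `K = H⁻¹`
in the coordinates `H^(1/2) ξ`, with reciprocal Rayleigh quotients. -/
theorem sum_erase_le_of_inverse_step (hpos : 0 < lam i₀) (hl₂ : ∀ j, j ≠ i₀ → l₂ ≤ lam j)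
    (hρ₀ : lam i₀ ≤ ρ) (hρ₂ : ρ < l₂) (hξ0 : ξ i₀ ≠ 0)
    (hξ : ∑ j, (lam j - ρ) * ‖ξ j‖ ^ 2 = 0) {γ : ℝ} (hγ0 : 0 ≤ γ) (hγ1 : γ < 1)
    (hg : ∀ j, (lam j : ℂ) * g j = ((lam j - ρ : ℝ) : ℂ) * ξ j)
    (hball : ∑ j, lam j * ‖ζ j - ξ j + g j‖ ^ 2 ≤ γ ^ 2 * ∑ j, lam j * ‖g j‖ ^ 2) :
    ζ i₀ ≠ 0 ∧ ∑ j ∈ Finset.univ.erase i₀, (lam j - ρ) * ‖ζ j‖ ^ 2 ≤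
      (γ + (1 - γ) * (lam i₀ / l₂)) ^ 2 * ((ρ - lam i₀) * ‖ζ i₀‖ ^ 2) := by
  have hρ : 0 < ρ := hpos.trans_le hρ₀
  have hl : 0 < l₂ := hρ.trans hρ₂
  have hlam (j : ι) : 0 < lam j := by
    by_cases hj : j = i₀
    · exact hj ▸ hpos
    · exact hl.trans_le (hl₂ j hj)
  have hρC : (ρ : ℂ) ≠ 0 := by exact_mod_cast hρ.ne'
  have hlamC (j : ι) : (lam j : ℂ) ≠ 0 := by exact_mod_cast (hlam j).ne'
  have hsqrt (j : ι) : √(lam j) ≠ 0 := (Real.sqrt_pos.mpr (hlam j)).ne'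
  set y : ι → ℂ := fun j => (√(lam j) : ℝ) * ξ j with hydef
  set z : ι → ℂ := fun j => (√(lam j) / ρ : ℝ) * ζ j with hzdef
  have hynorm (j : ι) : ‖y j‖ ^ 2 = lam j * ‖ξ j‖ ^ 2 := by
    simp only [hydef, norm_mul, Complex.norm_real, Real.norm_eq_abs, mul_pow, sq_abs,
      Real.sq_sqrt (hlam j).le]
  have hznorm (j : ι) : ‖z j‖ ^ 2 = lam j / ρ ^ 2 * ‖ζ j‖ ^ 2 := by
    simp only [hzdef, norm_mul, Complex.norm_real, Real.norm_eq_abs, mul_pow, sq_abs, div_pow,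
      Real.sq_sqrt (hlam j).le]
  have hgξ (j : ι) : g j = ((lam j - ρ) / lam j : ℝ) * ξ j := by
    have := hg j
    push_cast at this ⊢
    field_simp [hlamC j]
    linear_combination this
  have hgnorm (j : ι) : ‖g j‖ ^ 2 = ((lam j - ρ) / lam j) ^ 2 * ‖ξ j‖ ^ 2 := by
    rw [hgξ, norm_mul, Complex.norm_real, Real.norm_eq_abs, mul_pow, sq_abs]
  have hdiff (j : ι) : ‖z j - ((lam j)⁻¹ : ℝ) * y j‖ ^ 2 =
      (ρ ^ 2)⁻¹ * (lam j * ‖ζ j - ξ j + g j‖ ^ 2) := by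
    have : z j - ((lam j)⁻¹ : ℝ) * y j = (√(lam j) / ρ : ℝ) * (ζ j - ξ j + g j) := by
      simp only [hzdef, hydef]
      rw [hgξ]
      push_cast
      field_simp [hlamC j]
      ring
    rw [this, norm_mul, Complex.norm_real, Real.norm_eq_abs, mul_pow, sq_abs, div_pow,
      Real.sq_sqrt (hlam j).le]
    ring
  have hres (j : ι) : (ρ⁻¹ - (lam j)⁻¹) ^ 2 * ‖y j‖ ^ 2 =
      (ρ ^ 2)⁻¹ * (lam j * ‖g j‖ ^ 2) := by
    rw [hynorm, hgnorm]
    have := (hlam j).ne'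
    field_simp
  have hy : ∑ j, (ρ⁻¹ - (lam j)⁻¹) * ‖y j‖ ^ 2 = 0 := by
    rw [← mul_zero ρ⁻¹, ← hξ, Finset.mul_sum]
    refine Finset.sum_congr rfl fun j _ => ?_
    rw [hynorm]
    have := (hlam j).ne'
    field_simp
  have key := sum_erase_le_of_mem_ball (κ := fun j => (lam j)⁻¹) (i₀ := i₀) (m₂ := l₂⁻¹)
    (μ := ρ⁻¹) (y := y) (fun j => (inv_pos.mpr (hlam j)).le)
    (fun j hj => inv_anti₀ hl (hl₂ j hj)) (inv_pos.mpr hl).le (inv_strictAnti₀ hρ hρ₂)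
    (inv_anti₀ hpos hρ₀) (inv_pos.mpr hρ)
    (mul_ne_zero (by exact_mod_cast hsqrt i₀) hξ0) hy hγ0 hγ1 (z := z) (by
      simp only [hdiff, hres, ← Finset.mul_sum]
      rw [mul_left_comm]
      exact mul_le_mul_of_nonneg_left hball (by positivity))
  obtain ⟨hz0, hle⟩ := key
  refine ⟨right_ne_zero_of_mul hz0, ?_⟩
  have hL : ∑ j ∈ Finset.univ.erase i₀, (ρ⁻¹ - (lam j)⁻¹) * ‖z j‖ ^ 2 =
      (ρ ^ 3)⁻¹ * ∑ j ∈ Finset.univ.erase i₀, (lam j - ρ) * ‖ζ j‖ ^ 2 := by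
    rw [Finset.mul_sum]
    refine Finset.sum_congr rfl fun j _ => ?_
    rw [hznorm]
    have := (hlam j).ne'
    field_simp
  have hR : ((lam i₀)⁻¹ - ρ⁻¹) * ‖z i₀‖ ^ 2 = (ρ ^ 3)⁻¹ * ((ρ - lam i₀) * ‖ζ i₀‖ ^ 2) := by
    rw [hznorm]
    field_simp
  rw [hL, hR, inv_div_inv, mul_left_comm] at hle
  exact le_of_mul_le_mul_left hle (by positivity)

/-- A cone bound turned into a bound for the Rayleigh quotient `ρ'` of `ζ`. -/
theorem rayleigh_ratio_le (hl₂ : ∀ j, j ≠ i₀ → l₂ ≤ lam j) (hρ₀ : lam i₀ ≤ ρ) (hρ₂ : ρ < l₂)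
    {q ρ' : ℝ} (hq0 : 0 ≤ q) (hq1 : q ≤ 1) (hζ0 : ζ i₀ ≠ 0)
    (hζ : ∑ j ∈ Finset.univ.erase i₀, (lam j - ρ) * ‖ζ j‖ ^ 2 ≤
      q ^ 2 * ((ρ - lam i₀) * ‖ζ i₀‖ ^ 2))
    (hρ' : ρ' * ∑ j, ‖ζ j‖ ^ 2 = ∑ j, lam j * ‖ζ j‖ ^ 2) :
    ρ' < l₂ ∧ (ρ' - lam i₀) * (l₂ - ρ) ≤ q ^ 2 * (ρ - lam i₀) * (l₂ - ρ') := by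
  have hZ : 0 < ‖ζ i₀‖ ^ 2 := pow_pos (norm_pos_iff.mpr hζ0) 2
  rw [sum_eq_add_sum_erase i₀, sum_eq_add_sum_erase i₀ (fun j => lam j * ‖ζ j‖ ^ 2)] at hρ'
  have hs : 0 ≤ ∑ j ∈ Finset.univ.erase i₀, ‖ζ j‖ ^ 2 := Finset.sum_nonneg fun _ _ => sq_nonneg _
  have hL : l₂ * ∑ j ∈ Finset.univ.erase i₀, ‖ζ j‖ ^ 2 ≤
      ∑ j ∈ Finset.univ.erase i₀, lam j * ‖ζ j‖ ^ 2 := by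
    rw [Finset.mul_sum]
    exact Finset.sum_le_sum fun j hj =>
      mul_le_mul_of_nonneg_right (hl₂ j (Finset.ne_of_mem_erase hj)) (sq_nonneg _)
  simp only [sub_mul, Finset.sum_sub_distrib, ← Finset.mul_sum] at hζ
  set Z := ‖ζ i₀‖ ^ 2
  set s := ∑ j ∈ Finset.univ.erase i₀, ‖ζ j‖ ^ 2
  set L := ∑ j ∈ Finset.univ.erase i₀, lam j * ‖ζ j‖ ^ 2
  set l₁ := lam i₀
  have hq2 : q ^ 2 ≤ 1 := pow_le_one₀ hq0 hq1
  have hρl : 0 ≤ ρ - l₁ := by linarith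
  have hqZ : q ^ 2 * (ρ * Z - l₁ * Z) ≤ (ρ - l₁) * Z := by
    have := mul_le_mul_of_nonneg_right hq2 (mul_nonneg hρl hZ.le)
    linarith
  have hsum : 0 < Z + s := by linarith
  have hlow : (l₂ - ρ') * (Z + s) = (l₂ - l₁) * Z - (L - l₂ * s) := by linarith
  have hupp : (ρ' - l₁) * (Z + s) = (l₂ - l₁) * s + (L - l₂ * s) := by linarith
  have hδ : 0 ≤ L - l₂ * s := by linarith
  have hlt : ρ' < l₂ := by
    have h1 : 0 ≤ (l₂ - ρ) * s := mul_nonneg (by linarith) hs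
    have h2 : 0 < (l₂ - ρ) * Z := mul_pos (by linarith) hZ
    have : 0 < (l₂ - ρ') * (Z + s) := by rw [hlow]; linarith
    linarith [pos_of_mul_pos_left this hsum.le]
  refine ⟨hlt, le_of_mul_le_mul_right ?_ hsum⟩
  calc (ρ' - l₁) * (l₂ - ρ) * (Z + s) = (l₂ - l₁) * ((l₂ - ρ) * s) + (L - l₂ * s) * (l₂ - ρ) := by
        rw [mul_right_comm, hupp]; ring
    _ ≤ (l₂ - l₁) * (q ^ 2 * (ρ * Z - l₁ * Z) - (L - l₂ * s)) + (L - l₂ * s) * (l₂ - ρ) := by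
        gcongr
        · linarith
        · linarith
    _ = q ^ 2 * (ρ - l₁) * ((l₂ - l₁) * Z) - (ρ - l₁) * (L - l₂ * s) := by ring
    _ ≤ q ^ 2 * (ρ - l₁) * ((l₂ - l₁) * Z) - q ^ 2 * ((ρ - l₁) * (L - l₂ * s)) := by
        have := mul_le_of_le_one_left (mul_nonneg hρl hδ) hq2
        linarith
    _ = q ^ 2 * (ρ - l₁) * (l₂ - ρ') * (Z + s) := by rw [mul_assoc _ (l₂ - ρ'), hlow]; ring

end Step

/-! ### Quality of the preconditioner -/

theorem norm_add_real_smul_sq {G : Type*} [NormedAddCommGroup G] [InnerProductSpace ℂ G] (a b : G)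
    (s : ℝ) :
    ‖a + (s : ℂ) • b‖ ^ 2 = ‖a‖ ^ 2 + 2 * s * (inner ℂ a b).re + s ^ 2 * ‖b‖ ^ 2 := by
  rw [norm_add_sq (𝕜 := ℂ), inner_smul_right, norm_smul, Complex.norm_real, Real.norm_eq_abs,
    mul_pow, sq_abs]
  simp only [RCLike.re_to_complex, Complex.re_ofReal_mul]
  ring

/-- If the form `‖M u‖²` is within relative distortion `η` of `‖A u‖²`, then `1 - η²` is the scaling
for which the preconditioned residual `u` approximates `g = (A* A)⁻¹ (M* M) u` with relative error
`η` in the `A* A`-norm. -/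
theorem norm_map_sub_smul_le {E F F' : Type*} [NormedAddCommGroup E] [InnerProductSpace ℂ E]
    [NormedAddCommGroup F] [InnerProductSpace ℂ F] [NormedAddCommGroup F'] [InnerProductSpace ℂ F']
    (A : E →ₗ[ℂ] F) (M : E →ₗ[ℂ] F') {η : ℝ} (hη0 : 0 ≤ η) (hη1 : η < 1)
    (hM : ∀ x, (1 - η) * ‖A x‖ ^ 2 ≤ ‖M x‖ ^ 2 ∧ ‖M x‖ ^ 2 ≤ (1 + η) * ‖A x‖ ^ 2)
    {u g : E} (hug : ∀ x, inner ℂ (M x) (M u) = inner ℂ (A x) (A g)) :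
    ‖A (g - ((1 - η ^ 2 : ℝ) : ℂ) • u)‖ ^ 2 ≤ η ^ 2 * ‖A g‖ ^ 2 := by
  set v := g - u with hv
  have hg : g = v + u := by simp [hv]
  -- The form `D = M* M - A* A` satisfies `⟨v, D u⟩ = ‖A v‖²`; polarization bounds it by `η`.
  have hD : ‖A v‖ ^ 2 = (inner ℂ (M v) (M u)).re - (inner ℂ (A v) (A u)).re := by
    rw [hug v, hg, map_add, inner_add_right, Complex.add_re]
    have : (inner ℂ (A v) (A v)).re = ‖A v‖ ^ 2 := inner_self_eq_norm_sq (𝕜 := ℂ) (A v)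
    linarith
  have hpol (s : ℝ) : 2 * s * ‖A v‖ ^ 2 ≤ η * (‖A v‖ ^ 2 + s ^ 2 * ‖A u‖ ^ 2) := by
    have h1 := (hM (v + (s : ℂ) • u)).2
    have h2 := (hM (v + ((-s : ℝ) : ℂ) • u)).1
    simp only [map_add, map_smul, norm_add_real_smul_sq] at h1 h2
    have h3 : 2 * s * ‖A v‖ ^ 2 =
        2 * s * (inner ℂ (M v) (M u)).re - 2 * s * (inner ℂ (A v) (A u)).re := by
      rw [hD]; ring
    linarith
  have hb : ‖A v‖ ^ 2 ≤ η ^ 2 * ‖A u‖ ^ 2 := by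
    rcases hη0.eq_or_lt with rfl | hη
    · linarith [hpol 1]
    · have := hpol η
      have h3 : η * ‖A v‖ ^ 2 ≤ η * (η ^ 2 * ‖A u‖ ^ 2) := by linarith
      exact le_of_mul_le_mul_left h3 hη
  have h4 : g - ((1 - η ^ 2 : ℝ) : ℂ) • u = v + ((η ^ 2 : ℝ) : ℂ) • u := by
    rw [hg]; push_cast; module
  have h5 : g = v + ((1 : ℝ) : ℂ) • u := by simp [hv]
  rw [h4, congrArg A h5]
  simp only [map_add, map_smul, norm_add_real_smul_sq]
  have h6 : 0 ≤ 1 - η ^ 2 := by nlinarith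
  nlinarith [mul_le_mul_of_nonneg_left hb h6]


/-! ### The Gram matrix in its eigenbasis -/

section Gram

variable {d m n : ℕ}

theorem act_mul (B : Matrix (Fin d) (Fin m) ℂ) (A : Matrix (Fin m) (Fin n) ℂ) (x : Vec n) :
    act (B * A) x = act B (act A x) := by
  simp only [act, Matrix.toEuclideanLin, Matrix.toLpLin_mul (q := 2), LinearMap.comp_apply]

theorem act_one (x : Vec n) : act (1 : Matrix (Fin n) (Fin n) ℂ) x = x := by
  simp [act]

theorem act_smul (A : Matrix (Fin m) (Fin n) ℂ) (c : ℂ) (x : Vec n) :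
    act A (c • x) = c • act A x :=
  map_smul _ _ _

theorem inner_act_right (A : Matrix (Fin m) (Fin n) ℂ) (x : Vec m) (y : Vec n) :
    inner ℂ x (act A y) = inner ℂ (act Aᴴ x) y := by
  simp only [act]
  rw [Matrix.toEuclideanLin_conjTranspose_eq_adjoint, LinearMap.adjoint_inner_left]

theorem inner_act_left (A : Matrix (Fin m) (Fin n) ℂ) (x : Vec n) (y : Vec m) :
    inner ℂ (act A x) y = inner ℂ x (act Aᴴ y) := by
  rw [inner_act_right, Matrix.conjTranspose_conjTranspose]

theorem norm_act_of_conjTranspose_mul_self {A : Matrix (Fin m) (Fin n) ℂ} (hA : Aᴴ * A = 1)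
    (x : Vec n) : ‖act A x‖ = ‖x‖ := by
  have h : inner ℂ (act A x) (act A x) = inner ℂ x x := by
    rw [inner_act_left, ← act_mul, hA, act_one]
  rw [@norm_eq_sqrt_re_inner ℂ, h, ← @norm_eq_sqrt_re_inner ℂ]

theorem sq_sigma_succ (A : Matrix (Fin m) (Fin n) ℂ) (j : Fin n) :
    sigma A ((j : ℕ) + 1) ^ 2 =
      (Matrix.toEuclideanLin A).isSymmetric_adjoint_comp_self.eigenvalues
        (finrank_euclideanSpace_fin (𝕜 := ℂ)) j := by
  rw [sigma, Nat.add_sub_cancel, LinearMap.sq_singularValues_fin]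

theorem exists_orthonormalBasis_gram (A : Matrix (Fin m) (Fin n) ℂ) :
    ∃ (b : OrthonormalBasis (Fin n) ℂ (Vec n)) (lam : Fin n → ℝ),
      (∀ j, lam j = sigma A ((j : ℕ) + 1) ^ 2) ∧
        ∀ j, act Aᴴ (act A (b j)) = (lam j : ℂ) • b j := by
  refine ⟨(Matrix.toEuclideanLin A).isSymmetric_adjoint_comp_self.eigenvectorBasis
    (finrank_euclideanSpace_fin (𝕜 := ℂ)), _, fun j => (sq_sigma_succ A j).symm, fun j => ?_⟩
  have h := (Matrix.toEuclideanLin A).isSymmetric_adjoint_comp_self.apply_eigenvectorBasis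
    (finrank_euclideanSpace_fin (𝕜 := ℂ)) j
  rw [LinearMap.comp_apply] at h
  simp only [act]
  rw [Matrix.toEuclideanLin_conjTranspose_eq_adjoint]
  exact h

variable {A : Matrix (Fin m) (Fin n) ℂ} {b : OrthonormalBasis (Fin n) ℂ (Vec n)} {lam : Fin n → ℝ}

theorem inner_gram (hb : ∀ j, act Aᴴ (act A (b j)) = (lam j : ℂ) • b j) (j : Fin n) (x : Vec n) :
    inner ℂ (b j) (act Aᴴ (act A x)) = lam j * inner ℂ (b j) x := by
  rw [← inner_act_left, inner_act_right, hb, inner_smul_left, Complex.conj_ofReal]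

theorem norm_act_sq (hb : ∀ j, act Aᴴ (act A (b j)) = (lam j : ℂ) • b j) (x : Vec n) :
    ‖act A x‖ ^ 2 = ∑ j, lam j * ‖inner ℂ (b j) x‖ ^ 2 := by
  have h1 : ((‖act A x‖ ^ 2 : ℝ) : ℂ) = inner ℂ (act A x) (act A x) := by
    rw [inner_self_eq_norm_sq_to_K]; norm_cast
  have h2 : inner ℂ (act A x) (act A x) = ((∑ j, lam j * ‖inner ℂ (b j) x‖ ^ 2 : ℝ) : ℂ) := by
    rw [inner_act_left, ← b.sum_inner_mul_inner]
    push_cast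
    refine Finset.sum_congr rfl fun j _ => ?_
    rw [inner_gram hb, mul_left_comm, ← inner_conj_symm x (b j), Complex.conj_mul']
  exact_mod_cast h1.trans h2

theorem le_norm_act_sq (hb : ∀ j, act Aᴴ (act A (b j)) = (lam j : ℂ) • b j) {l : ℝ}
    (hl : ∀ j, l ≤ lam j) (x : Vec n) : l * ‖x‖ ^ 2 ≤ ‖act A x‖ ^ 2 := by
  rw [norm_act_sq hb, ← b.sum_sq_norm_inner_right x, Finset.mul_sum]
  exact Finset.sum_le_sum fun j _ => mul_le_mul_of_nonneg_right (hl j) (sq_nonneg _)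

end Gram

/-! ### Rayleigh quotient decrease in one LOBPCG step -/

/-- One LOBPCG step contracts the ratio `(ρ - λ₁) / (λ₂ - ρ)` of the Rayleigh quotient
`ρ = ‖A v‖²` by `q²`. The minimizer over the trial space is compared with the fixed-step iterate
`v - (1 - η²) w`, whose step size makes the preconditioning error as small as possible. -/
theorem IsLOBPCGStep.ratio_le {d m n : ℕ} {A : Matrix (Fin m) (Fin n) ℂ}
    {M : Matrix (Fin d) (Fin n) ℂ} {P : Matrix (Fin n) (Fin n) ℂ} (hMP : Mᴴ * M * (P * Pᴴ) = 1)
    {η : ℝ} (hη0 : 0 ≤ η) (hη1 : η < 1)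
    (hM : ∀ x, (1 - η) * ‖act A x‖ ^ 2 ≤ ‖act M x‖ ^ 2 ∧ ‖act M x‖ ^ 2 ≤ (1 + η) * ‖act A x‖ ^ 2)
    {b : OrthonormalBasis (Fin n) ℂ (Vec n)} {lam : Fin n → ℝ}
    (hb : ∀ j, act Aᴴ (act A (b j)) = (lam j : ℂ) • b j)
    {i₀ : Fin n} {l₂ : ℝ} (hpos : 0 < lam i₀) (hl : lam i₀ < l₂) (hl₂ : ∀ j, j ≠ i₀ → l₂ ≤ lam j)
    {vOld v vNew : Vec n} (hv : ‖v‖ = 1) (hρ₂ : ‖act A v‖ ^ 2 < l₂)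
    (hstep : IsLOBPCGStep A P vOld v vNew) :
    ‖vNew‖ = 1 ∧ ‖act A vNew‖ ^ 2 < l₂ ∧
      (‖act A vNew‖ ^ 2 - lam i₀) * (l₂ - ‖act A v‖ ^ 2) ≤
        (η + (1 - η) * (lam i₀ / l₂)) ^ 2 * (‖act A v‖ ^ 2 - lam i₀) *
          (l₂ - ‖act A vNew‖ ^ 2) := by
  have hlam (j : Fin n) : lam i₀ ≤ lam j := by
    by_cases hj : j = i₀
    · rw [hj]
    · exact hl.le.trans (hl₂ j hj)
  set ρ := ‖act A v‖ ^ 2 with hρdef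
  have hρ₀ : lam i₀ ≤ ρ := by simpa [hv] using le_norm_act_sq hb hlam v
  have hξ : ∑ j, (lam j - ρ) * ‖inner ℂ (b j) v‖ ^ 2 = 0 := by
    simp only [sub_mul, Finset.sum_sub_distrib, ← Finset.mul_sum]
    rw [← norm_act_sq hb, b.sum_sq_norm_inner_right, hv]
    simp [hρdef]
  have hξ0 : inner ℂ (b i₀) v ≠ 0 := by
    intro h0
    have h1 : l₂ * ∑ j, ‖inner ℂ (b j) v‖ ^ 2 ≤ ρ := by
      rw [hρdef, norm_act_sq hb, Finset.mul_sum]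
      refine Finset.sum_le_sum fun j _ => ?_
      by_cases hj : j = i₀
      · simp [hj, h0]
      · exact mul_le_mul_of_nonneg_right (hl₂ j hj) (sq_nonneg _)
    rw [b.sum_sq_norm_inner_right, hv] at h1
    linarith
  -- `g = H⁻¹ r` for the residual `r`, written in the eigenbasis of `H = A* A`.
  set r := act Aᴴ (act A v) - ((‖act A v‖ ^ 2 : ℝ) : ℂ) • v with hr
  have hrj (j : Fin n) : inner ℂ (b j) r = ((lam j - ρ : ℝ) : ℂ) * inner ℂ (b j) v := by
    rw [hr, inner_sub_right, inner_gram hb, inner_smul_right, ← hρdef]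
    push_cast
    ring
  set g : Vec n := ∑ j, (((lam j : ℂ))⁻¹ * inner ℂ (b j) r) • b j with hg
  have hgj (j : Fin n) : inner ℂ (b j) g = ((lam j : ℂ))⁻¹ * inner ℂ (b j) r := by
    rw [hg, b.orthonormal.inner_right_fintype]
  have hgj' (j : Fin n) : (lam j : ℂ) * inner ℂ (b j) g = inner ℂ (b j) r := by
    have : (lam j : ℂ) ≠ 0 := by exact_mod_cast (hpos.trans_le (hlam j)).ne'
    rw [hgj, mul_inv_cancel_left₀ this]
  have hHg : act Aᴴ (act A g) = r := by
    refine b.repr.injective (PiLp.ext fun j => ?_)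
    rw [b.repr_apply_apply, b.repr_apply_apply, inner_gram hb, hgj']
  set w := searchDir A P v with hw
  have hwr : act Mᴴ (act M w) = r := by
    have : w = act (P * Pᴴ) r := by rw [act_mul]; rfl
    rw [this, ← act_mul, ← act_mul, hMP, act_one]
  have hball := norm_map_sub_smul_le (Matrix.toEuclideanLin A) (Matrix.toEuclideanLin M) hη0 hη1 hM
    (u := w) (g := g) fun x => by
      have h1 := inner_act_left M x (act M w)
      have h2 := inner_act_left A x (act A g)
      rw [hwr] at h1
      rw [hHg] at h2
      exact h1.trans h2.symm
  set z := v - ((1 - η ^ 2 : ℝ) : ℂ) • w with hz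
  obtain ⟨hz0, hcone⟩ := sum_erase_le_of_inverse_step (ζ := fun j => inner ℂ (b j) z)
    (g := fun j => inner ℂ (b j) g) hpos hl₂ hρ₀ hρ₂ hξ0 hξ hη0 hη1
    (fun j => (hgj' j).trans (hrj j)) (by
      have h1 (j : Fin n) : inner ℂ (b j) z - inner ℂ (b j) v + inner ℂ (b j) g =
          inner ℂ (b j) (g - ((1 - η ^ 2 : ℝ) : ℂ) • w) := by
        rw [hz, inner_sub_right, inner_sub_right]; ring
      simp only [h1]
      rw [← norm_act_sq hb, ← norm_act_sq hb]
      exact hball)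
  have hzne : z ≠ 0 := by
    intro h
    exact hz0 (by rw [h, inner_zero_right])
  have hznorm : 0 < ‖z‖ := norm_pos_iff.mpr hzne
  set q := η + (1 - η) * (lam i₀ / l₂) with hq
  have hl₂0 : 0 < l₂ := hpos.trans hl
  have hq0 : 0 ≤ q := add_nonneg hη0 (mul_nonneg (by linarith) (div_nonneg hpos.le hl₂0.le))
  have hq1 : q ≤ 1 := by
    have : lam i₀ / l₂ ≤ 1 := (div_le_one hl₂0).mpr hl.le
    nlinarith
  obtain ⟨hlt, hle⟩ := rayleigh_ratio_le hl₂ hρ₀ hρ₂ hq0 hq1 hz0 hcone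
    (ρ' := ‖act A z‖ ^ 2 / ‖z‖ ^ 2) (by
      rw [b.sum_sq_norm_inner_right, ← norm_act_sq hb, div_mul_cancel₀ _ (by positivity)])
  have hmem : ((‖z‖⁻¹ : ℝ) : ℂ) • z ∈ trialSphere A P vOld v := by
    refine ⟨Submodule.smul_mem _ _ (Submodule.sub_mem _ ?_ (Submodule.smul_mem _ _ ?_)), ?_⟩
    · exact Submodule.subset_span (by simp)
    · exact Submodule.subset_span (by simp [hw])
    · rw [norm_smul, Complex.norm_real, norm_inv, norm_norm, inv_mul_cancel₀ hznorm.ne']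
  have hmin : ‖act A vNew‖ ^ 2 ≤ ‖act A z‖ ^ 2 / ‖z‖ ^ 2 := by
    have h1 : ‖act A vNew‖ ≤ ‖act A (((‖z‖⁻¹ : ℝ) : ℂ) • z)‖ := hstep.isMin hmem
    rw [act_smul, norm_smul, Complex.norm_real, norm_inv, norm_norm, inv_mul_eq_div] at h1
    rw [← div_pow]
    exact pow_le_pow_left₀ (norm_nonneg _) h1 2
  refine ⟨hstep.mem.2, hmin.trans_lt hlt, ?_⟩
  calc _ ≤ (‖act A z‖ ^ 2 / ‖z‖ ^ 2 - lam i₀) * (l₂ - ρ) :=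
        mul_le_mul_of_nonneg_right (by linarith) (by linarith)
    _ ≤ _ := hle
    _ ≤ _ := mul_le_mul_of_nonneg_left (by linarith)
        (mul_nonneg (sq_nonneg _) (by linarith))


/-! ### The sketched singular value decomposition -/

section SVD

variable {d n : ℕ} {M U : Matrix (Fin d) (Fin n) ℂ} {s : Fin n → ℝ} {V : Matrix (Fin n) (Fin n) ℂ}

theorem IsEconomySVD.conjTranspose_mul_self (h : IsEconomySVD M U s V) : Vᴴ * V = 1 :=
  Matrix.mem_unitaryGroup_iff'.mp h.right_unitary

theorem IsEconomySVD.mul_conjTranspose_self (h : IsEconomySVD M U s V) : V * Vᴴ = 1 :=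
  Matrix.mem_unitaryGroup_iff.mp h.right_unitary

theorem IsEconomySVD.mul_right (h : IsEconomySVD M U s V) :
    M * V = U * Matrix.diagonal (fun i => (s i : ℂ)) := by
  rw [h.factorization, Matrix.mul_assoc, h.conjTranspose_mul_self, Matrix.mul_one]

theorem IsEconomySVD.pos (h : IsEconomySVD M U s V) (hM : ∀ x, act M x = 0 → x = 0) (i : Fin n) :
    0 < s i := by
  refine (h.nonneg i).lt_of_ne' fun hi => ?_
  have h1 : act (M * V) (EuclideanSpace.single i 1) = 0 := by
    rw [h.mul_right, act_mul]
    have : act (Matrix.diagonal (fun i => (s i : ℂ))) (EuclideanSpace.single i 1) = 0 := by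
      ext j
      by_cases hj : j = i <;> simp [act, Matrix.mulVec_diagonal, hj, hi]
    rw [this]
    exact map_zero _
  rw [act_mul] at h1
  have h2 := norm_act_of_conjTranspose_mul_self h.conjTranspose_mul_self
    (EuclideanSpace.single i (1 : ℂ))
  rw [hM _ h1] at h2
  simp at h2

theorem IsEconomySVD.mul_preconditioner (h : IsEconomySVD M U s V) (hs : ∀ i, 0 < s i) :
    M * preconditioner s V = U := by
  have hsC (i : Fin n) : (s i : ℂ) ≠ 0 := by exact_mod_cast (hs i).ne'
  rw [preconditioner, ← Matrix.mul_assoc, h.mul_right, Matrix.mul_assoc,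
    Matrix.diagonal_mul_diagonal]
  simp [hsC]

/-- The preconditioner `P P*` is the inverse of the sketched Gram matrix. -/
theorem IsEconomySVD.gram_mul_preconditioner (h : IsEconomySVD M U s V) (hs : ∀ i, 0 < s i) :
    Mᴴ * M * (preconditioner s V * (preconditioner s V)ᴴ) = 1 := by
  have h1 : (M * preconditioner s V)ᴴ * (M * preconditioner s V) = 1 := by
    rw [h.mul_preconditioner hs, h.left_orthonormal]
  have h2 : (preconditioner s V)ᴴ * (Mᴴ * M * preconditioner s V) = 1 := by
    rw [← h1, Matrix.conjTranspose_mul]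
    simp only [Matrix.mul_assoc]
  rw [← Matrix.mul_assoc]
  exact mul_eq_one_comm.mp h2

theorem norm_lastBasisVec (hn : 0 < n) : ‖lastBasisVec n‖ = 1 := by
  have : lastBasisVec n = EuclideanSpace.single (⟨n - 1, by omega⟩ : Fin n) (1 : ℂ) := by
    ext i
    have : (i : ℕ) + 1 = n ↔ i = ⟨n - 1, by omega⟩ := by rw [Fin.ext_iff]; simp only; omega
    simp [lastBasisVec, this]
  rw [this]
  simp

theorem norm_preconditioner_lastBasisVec (h : IsEconomySVD M U s V) (hs : ∀ i, 0 < s i)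
    {i₀ : Fin n} (hi₀ : (i₀ : ℕ) + 1 = n) :
    ‖act (preconditioner s V) (lastBasisVec n)‖ = (s i₀)⁻¹ := by
  have h1 : act (Matrix.diagonal (fun i => ((s i)⁻¹ : ℂ))) (lastBasisVec n) =
      ((s i₀)⁻¹ : ℂ) • lastBasisVec n := by
    ext i
    by_cases hi : (i : ℕ) + 1 = n
    · have : i = i₀ := Fin.ext (by omega)
      subst this
      simp [act, lastBasisVec, Matrix.mulVec_diagonal]
    · simp [act, lastBasisVec, Matrix.mulVec_diagonal, hi]
  rw [preconditioner, act_mul, norm_act_of_conjTranspose_mul_self h.conjTranspose_mul_self, h1,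
    norm_smul, norm_lastBasisVec (by omega), norm_inv, Complex.norm_real, Real.norm_eq_abs,
    abs_of_pos (hs i₀), mul_one]

theorem norm_startVec (h : IsEconomySVD M U s V) (hs : ∀ i, 0 < s i) (hn : 0 < n) :
    ‖startVec (preconditioner s V)‖ = 1 := by
  have hi₀ : ((⟨n - 1, by omega⟩ : Fin n) : ℕ) + 1 = n := by simp only; omega
  rw [startVec, norm_smul, Complex.norm_real, norm_inv, norm_norm, inv_mul_cancel₀]
  rw [norm_preconditioner_lastBasisVec h hs hi₀]
  exact (inv_pos.mpr (hs _)).ne'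

/-- The starting vector minimizes the sketched objective on the unit sphere. -/
theorem norm_act_startVec_le (h : IsEconomySVD M U s V) (hs : ∀ i, 0 < s i) (hn : 0 < n)
    {x : Vec n} (hx : ‖x‖ = 1) :
    ‖act M (startVec (preconditioner s V))‖ ≤ ‖act M x‖ := by
  set i₀ : Fin n := ⟨n - 1, by omega⟩
  have hi₀ : (i₀ : ℕ) + 1 = n := by simp only [i₀]; omega
  have h1 : ‖act M (startVec (preconditioner s V))‖ = s i₀ := by
    rw [startVec, act_smul, norm_smul, ← act_mul, h.mul_preconditioner hs,
      norm_act_of_conjTranspose_mul_self h.left_orthonormal, norm_lastBasisVec hn,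
      Complex.norm_real, norm_inv, norm_norm, norm_preconditioner_lastBasisVec h hs hi₀, inv_inv,
      mul_one]
  have hVx : ‖act Vᴴ x‖ = 1 := by
    rw [norm_act_of_conjTranspose_mul_self (by simpa using h.mul_conjTranspose_self), hx]
  have h2 : ‖act M x‖ = ‖act (Matrix.diagonal (fun i => (s i : ℂ))) (act Vᴴ x)‖ := by
    rw [h.factorization, act_mul, act_mul, norm_act_of_conjTranspose_mul_self h.left_orthonormal]
  rw [h1, h2]
  refine le_of_sq_le_sq ?_ (norm_nonneg _)
  rw [EuclideanSpace.norm_sq_eq]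
  calc s i₀ ^ 2 = s i₀ ^ 2 * ‖act Vᴴ x‖ ^ 2 := by rw [hVx]; ring
    _ ≤ _ := by
      rw [EuclideanSpace.norm_sq_eq, Finset.mul_sum]
      refine Finset.sum_le_sum fun i _ => ?_
      have hle : s i₀ ≤ s i := h.antitone (by rw [Fin.le_def]; have := i.2; omega)
      have h3 : (act (Matrix.diagonal (fun i => (s i : ℂ))) (act Vᴴ x)) i =
          s i * (act Vᴴ x) i := by
        simp only [act]
        rw [Matrix.ofLp_toLpLin, Matrix.toLin'_apply, Matrix.mulVec_diagonal]
      rw [h3, norm_mul, Complex.norm_real, Real.norm_eq_abs, mul_pow, sq_abs]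
      exact mul_le_mul_of_nonneg_right (pow_le_pow_left₀ (hs i₀).le hle 2) (sq_nonneg _)

end SVD

/-! ### Angles and the Rayleigh quotient -/

/-- For a unit vector `v`, the squared tangent of the angle to the minimal right singular vector is
at most `(ρ - λ₁) / (λ₂ - ρ)` with `ρ = ‖A v‖²`; the bound `K` on this ratio is stated without
division. -/
theorem sin_le_tan_and_tan_le {m n : ℕ} {A : Matrix (Fin m) (Fin n) ℂ}
    {b : OrthonormalBasis (Fin n) ℂ (Vec n)} {lam : Fin n → ℝ}
    (hb : ∀ j, act Aᴴ (act A (b j)) = (lam j : ℂ) • b j)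
    {i₀ : Fin n} {l₂ : ℝ} (hl : lam i₀ < l₂) (hl₂ : ∀ j, j ≠ i₀ → l₂ ≤ lam j)
    {vmin v : Vec n} (hmin : ‖vmin‖ = 1) (hgram : act Aᴴ (act A vmin) = (lam i₀ : ℂ) • vmin)
    (hv : ‖v‖ = 1) (hρ₂ : ‖act A v‖ ^ 2 < l₂) {K : ℝ} (hK : 0 ≤ K)
    (hρ : ‖act A v‖ ^ 2 - lam i₀ ≤ K * (l₂ - ‖act A v‖ ^ 2)) :
    |Real.sin (lineAngle v vmin)| ≤ |Real.tan (lineAngle v vmin)| ∧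
      |Real.tan (lineAngle v vmin)| ≤ √K := by
  -- The smallest eigenvalue is simple, so `vmin` is a phase multiple of `b i₀`.
  have hne (j : Fin n) (hj : j ≠ i₀) : inner ℂ (b j) vmin = 0 := by
    have h1 := inner_gram hb j vmin
    rw [hgram, inner_smul_right] at h1
    have h2 : (lam j : ℂ) - lam i₀ ≠ 0 := by
      have := (hl.trans_le (hl₂ j hj)).ne'
      rw [sub_ne_zero]
      exact_mod_cast this
    have h3 : ((lam j : ℂ) - lam i₀) * inner ℂ (b j) vmin = 0 := by linear_combination -h1
    exact (mul_eq_zero.mp h3).resolve_left h2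
  have hphase : ‖inner ℂ (b i₀) vmin‖ ^ 2 = 1 := by
    have h1 := b.sum_sq_norm_inner_right vmin
    rw [hmin, Finset.sum_eq_single i₀ (fun j _ hj => by simp [hne j hj]) (by simp)] at h1
    simpa using h1
  set c := ‖inner ℂ v vmin‖ with hc
  have hc2 : c ^ 2 = ‖inner ℂ (b i₀) v‖ ^ 2 := by
    rw [hc, ← b.sum_inner_mul_inner v vmin,
      Finset.sum_eq_single i₀ (fun j _ hj => by simp [hne j hj]) (by simp), norm_mul, mul_pow,
      hphase, mul_one, norm_inner_symm]
  have hc0 : 0 ≤ c := norm_nonneg _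
  have hlow : lam i₀ * c ^ 2 + l₂ * (1 - c ^ 2) ≤ ‖act A v‖ ^ 2 := by
    have h1 := b.sum_sq_norm_inner_right v
    rw [hv, sum_eq_add_sum_erase i₀, ← hc2] at h1
    rw [norm_act_sq hb, sum_eq_add_sum_erase i₀, ← hc2,
      show 1 - c ^ 2 = ∑ j ∈ Finset.univ.erase i₀, ‖inner ℂ (b j) v‖ ^ 2 by linarith,
      Finset.mul_sum]
    exact add_le_add le_rfl (Finset.sum_le_sum fun j hj =>
      mul_le_mul_of_nonneg_right (hl₂ j (Finset.ne_of_mem_erase hj)) (sq_nonneg _))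
  have hcpos : 0 < c := by
    refine hc0.lt_of_ne fun h => ?_
    rw [← h] at hlow
    linarith
  have hc1 : c ≤ 1 := by
    simpa [hv, hmin] using norm_inner_le_norm (𝕜 := ℂ) v vmin
  have hangle : lineAngle v vmin = Real.arccos c := by simp [lineAngle, hv, hmin, hc]
  have hgap : 0 < l₂ - lam i₀ := by linarith
  have hkey : 1 - c ^ 2 ≤ K * c ^ 2 := by
    refine le_of_mul_le_mul_left ?_ hgap
    calc (l₂ - lam i₀) * (1 - c ^ 2) ≤ K * (l₂ - ‖act A v‖ ^ 2) := by linarith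
      _ ≤ K * ((l₂ - lam i₀) * c ^ 2) := mul_le_mul_of_nonneg_left (by linarith) hK
      _ = _ := by ring
  rw [hangle, Real.tan_arccos, Real.sin_arccos, abs_of_nonneg (Real.sqrt_nonneg _),
    abs_of_nonneg (div_nonneg (Real.sqrt_nonneg _) hc0)]
  refine ⟨(le_div_iff₀ hcpos).mpr (mul_le_of_le_one_right (Real.sqrt_nonneg _) hc1), ?_⟩
  rw [div_le_iff₀ hcpos, ← Real.sqrt_sq hc0, ← Real.sqrt_mul hK, Real.sqrt_sq hc0]
  exact Real.sqrt_le_sqrt hkey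

end RLOBPCG

/-! ### Convergence of the iteration -/

theorem theorem1 {d m n : ℕ} (hn : 2 ≤ n) (hmn : n ≤ m)
    (A : Matrix (Fin m) (Fin n) ℂ)
    (hA : ∀ j : ℕ, 1 ≤ j → j ≤ n → 0 < RLOBPCG.sigma A j)
    (S : Matrix (Fin d) (Fin m) ℂ) (η : ℝ) (hη0 : 0 ≤ η) (hη1 : η < 1)
    (hS : RLOBPCG.IsSubspaceEmbedding S A η)
    (hgap : η < RLOBPCG.relGap A / (2 + RLOBPCG.relGap A))
    (vmin : RLOBPCG.Vec n) (hvmin : RLOBPCG.IsMinRightSingularVector A vmin)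
    (U : Matrix (Fin d) (Fin n) ℂ) (s : Fin n → ℝ) (V : Matrix (Fin n) (Fin n) ℂ)
    (hSVD : RLOBPCG.IsEconomySVD (S * A) U s V)
    (v : ℕ → RLOBPCG.Vec n)
    (hv : RLOBPCG.IsIteration A (RLOBPCG.preconditioner s V) v) (k : ℕ) :
    (‖RLOBPCG.act A (v k)‖ ^ 2 - RLOBPCG.sigma A n ^ 2) / RLOBPCG.sigma A n ^ 2 ≤
        RLOBPCG.prefactor η (RLOBPCG.relGap A) * RLOBPCG.relGap A *
          RLOBPCG.rate η (RLOBPCG.relGap A) ^ (2 * k) ∧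
      |Real.sin (RLOBPCG.lineAngle (v k) vmin)| ≤ |Real.tan (RLOBPCG.lineAngle (v k) vmin)| ∧
      |Real.tan (RLOBPCG.lineAngle (v k) vmin)| ≤
        Real.sqrt (RLOBPCG.prefactor η (RLOBPCG.relGap A)) *
          RLOBPCG.rate η (RLOBPCG.relGap A) ^ k := by
  have hn0 : 0 < n := by omega
  set P := RLOBPCG.preconditioner s V with hP
  set σ₁ := RLOBPCG.sigma A n with hσ₁
  set σ₂ := RLOBPCG.sigma A (n - 1) with hσ₂
  have hσpos : 0 < σ₁ := hA n (by omega) le_rfl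
  have hl₁ : 0 < σ₁ ^ 2 := by positivity
  have hσle : σ₁ ≤ σ₂ :=
    (Matrix.toEuclideanLin A).singularValues_antitone (Nat.sub_le (n - 1) 1)
  set gap := RLOBPCG.relGap A with hgapdef
  have hgapmul : gap * σ₁ ^ 2 = σ₂ ^ 2 - σ₁ ^ 2 := by
    rw [hgapdef, RLOBPCG.relGap, div_mul_cancel₀ _ hl₁.ne']
  have hgap0 : 0 ≤ gap :=
    div_nonneg (sub_nonneg.mpr (pow_le_pow_left₀ hσpos.le hσle 2)) hl₁.le
  rw [lt_div_iff₀ (by linarith)] at hgap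
  have hD : 0 < (1 - η) * gap - 2 * η := by linarith
  have hgappos : 0 < gap := by
    refine hgap0.lt_of_ne fun h => ?_
    rw [← h] at hD
    linarith
  have hl : σ₁ ^ 2 < σ₂ ^ 2 := by linarith [mul_pos hgappos hl₁]
  -- The eigenvalues `σ_j²` of `A* A`; the index `i₀` is that of the smallest one.
  obtain ⟨b, lam, hlam, hb⟩ := RLOBPCG.exists_orthonormalBasis_gram A
  set i₀ : Fin n := ⟨n - 1, by omega⟩ with hi₀
  have hlam₀ : lam i₀ = σ₁ ^ 2 := by
    rw [hlam, hi₀, Nat.sub_add_cancel hn0]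
  have hl₂ (j : Fin n) (hj : j ≠ i₀) : σ₂ ^ 2 ≤ lam j := by
    have hjn : (j : ℕ) ≠ n - 1 := fun h => hj (Fin.ext h)
    rw [hlam]
    refine pow_le_pow_left₀ (hσpos.le.trans hσle) ?_ 2
    exact (Matrix.toEuclideanLin A).singularValues_antitone (by have := j.2; omega)
  have hlamge (j : Fin n) : σ₁ ^ 2 ≤ lam j := by
    by_cases hj : j = i₀
    · rw [hj, hlam₀]
    · exact hl.le.trans (hl₂ j hj)
  have hray (x : RLOBPCG.Vec n) : σ₁ ^ 2 * ‖x‖ ^ 2 ≤ ‖RLOBPCG.act A x‖ ^ 2 :=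
    RLOBPCG.le_norm_act_sq hb hlamge x
  have hM (x : RLOBPCG.Vec n) : (1 - η) * ‖RLOBPCG.act A x‖ ^ 2 ≤ ‖RLOBPCG.act (S * A) x‖ ^ 2 ∧
      ‖RLOBPCG.act (S * A) x‖ ^ 2 ≤ (1 + η) * ‖RLOBPCG.act A x‖ ^ 2 := by
    rw [RLOBPCG.act_mul]
    exact hS x
  have hs : ∀ i, 0 < s i := hSVD.pos fun x hx => by
    have h1 := (hM x).1
    rw [hx, norm_zero] at h1
    have h2 : 0 ≤ (1 - η) * (σ₁ ^ 2 * ‖x‖ ^ 2) := by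
      have : 0 ≤ 1 - η := by linarith
      positivity
    have h3 := mul_le_mul_of_nonneg_left (hray x) (by linarith : 0 ≤ 1 - η)
    have h4 : (1 - η) * (σ₁ ^ 2 * ‖x‖ ^ 2) = 0 := by linarith
    have h5 : (1 - η) ≠ 0 := by linarith
    simpa [h5, hl₁.ne', hσpos.ne'] using h4
  set C := RLOBPCG.prefactor η gap with hC
  set q := RLOBPCG.rate η gap with hq
  have hC0 : 0 ≤ C := div_nonneg (by linarith) hD.le
  have hq_eq : η + (1 - η) * (lam i₀ / σ₂ ^ 2) = q := by
    have h1 : σ₂ ^ 2 = (1 + gap) * σ₁ ^ 2 := by linarith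
    have h2 : (1 + gap) ≠ 0 := by linarith
    rw [hq, RLOBPCG.rate, hlam₀, h1]
    field_simp
  have hq0 : 0 ≤ q := by
    have : 0 ≤ 1 - η := by linarith
    rw [hq, RLOBPCG.rate]
    positivity
  have hmain : ∀ k, ‖v k‖ = 1 ∧ ‖RLOBPCG.act A (v k)‖ ^ 2 < σ₂ ^ 2 ∧
      ‖RLOBPCG.act A (v k)‖ ^ 2 - σ₁ ^ 2 ≤
        C * q ^ (2 * k) * (σ₂ ^ 2 - ‖RLOBPCG.act A (v k)‖ ^ 2) := by
    intro k
    induction k with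
    | zero =>
      have hv0 : ‖v 0‖ = 1 := by rw [hv.start]; exact RLOBPCG.norm_startVec hSVD hs hn0
      -- The start is optimal for the sketched problem, and each comparison with the true objective
      -- costs one side of the distortion bound.
      have hinit : (1 - η) * ‖RLOBPCG.act A (v 0)‖ ^ 2 ≤ (1 + η) * σ₁ ^ 2 := by
        have h1 : ‖RLOBPCG.act A vmin‖ ^ 2 = σ₁ ^ 2 := by
          have h2 : inner ℂ (RLOBPCG.act A vmin) (RLOBPCG.act A vmin) = ((σ₁ ^ 2 : ℝ) : ℂ) := by
            rw [RLOBPCG.inner_act_left, hvmin.gram, inner_smul_right, inner_self_eq_norm_sq_to_K,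
              hvmin.unit]
            simp [hσ₁]
          rw [← inner_self_eq_norm_sq (𝕜 := ℂ), h2]
          exact Complex.ofReal_re _
        calc _ ≤ _ := (hM (v 0)).1
          _ ≤ ‖RLOBPCG.act (S * A) vmin‖ ^ 2 := by
            rw [hv.start]
            exact pow_le_pow_left₀ (norm_nonneg _)
              (RLOBPCG.norm_act_startVec_le hSVD hs hn0 hvmin.unit) 2
          _ ≤ _ := (hM vmin).2
          _ = _ := by rw [h1]
      have h1 := hray (v 0)
      rw [hv0] at h1
      set ρ := ‖RLOBPCG.act A (v 0)‖ ^ 2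
      have hσ₂' : σ₂ ^ 2 = σ₁ ^ 2 + gap * σ₁ ^ 2 := by linarith
      have hDσ : 0 < ((1 - η) * gap - 2 * η) * σ₁ ^ 2 := mul_pos hD hl₁
      refine ⟨hv0, ?_, ?_⟩
      · have : 0 < (1 - η) * (σ₂ ^ 2 - ρ) := by rw [hσ₂']; linarith
        linarith [pos_of_mul_pos_right this (by linarith)]
      · rw [mul_zero, pow_zero, mul_one, hC, RLOBPCG.prefactor, div_mul_eq_mul_div,
          le_div_iff₀ hD, hσ₂']
        have := mul_le_mul_of_nonneg_left hinit hgap0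
        linarith
    | succ k ih =>
      obtain ⟨hvk, hlt, hle⟩ := ih
      obtain ⟨vOld, hstep⟩ : ∃ vOld, RLOBPCG.IsLOBPCGStep A P vOld (v k) (v (k + 1)) := by
        cases k with
        | zero => exact ⟨_, hv.first⟩
        | succ k => exact ⟨_, hv.next k⟩
      obtain ⟨h1, h2, h3⟩ := hstep.ratio_le (hSVD.gram_mul_preconditioner hs) hη0 hη1 hM hb
        (hlam₀ ▸ hl₁) (hlam₀ ▸ hl) hl₂ hvk hlt
      refine ⟨h1, h2, ?_⟩
      rw [hq_eq, hlam₀] at h3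
      refine le_of_mul_le_mul_right (h3.trans ?_) (sub_pos.mpr hlt)
      calc _ ≤ q ^ 2 * (C * q ^ (2 * k) * (σ₂ ^ 2 - ‖RLOBPCG.act A (v k)‖ ^ 2)) *
            (σ₂ ^ 2 - ‖RLOBPCG.act A (v (k + 1))‖ ^ 2) := by
            refine mul_le_mul_of_nonneg_right ?_ (sub_pos.mpr h2).le
            exact mul_le_mul_of_nonneg_left hle (sq_nonneg _)
        _ = _ := by ring
  obtain ⟨hvk, hlt, hle⟩ := hmain k
  have hK : 0 ≤ C * q ^ (2 * k) := mul_nonneg hC0 (pow_nonneg hq0 _)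
  refine ⟨?_, ?_⟩
  · rw [div_le_iff₀ hl₁]
    have h1 := hray (v k)
    rw [hvk] at h1
    calc _ ≤ _ := hle
      _ ≤ C * q ^ (2 * k) * (σ₂ ^ 2 - σ₁ ^ 2) := mul_le_mul_of_nonneg_left (by linarith) hK
      _ = _ := by rw [← hgapmul]; ring
  · have h := RLOBPCG.sin_le_tan_and_tan_le hb (hlam₀ ▸ hl) hl₂ hvmin.unit
      (by rw [hlam₀]; exact hvmin.gram) hvk hlt hK (by rw [hlam₀]; exact hle)
    rwa [Real.sqrt_mul hC0, mul_comm 2 k, pow_mul, Real.sqrt_sq (pow_nonneg hq0 _)] at h
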